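/- Let $T>0$, $n,m,r\in\mathbb N$, $B\in\mathbb R^{n,m}$, $C\in\mathbb R^{r,n}$, $x_0\in\mathbb R^n$ and $y\in L^2(0,T;\mathbb R^r)$. For a four-tuple $\mathcal S=(A,\Gamma,R,Q)\in\mathbb R^{n,n}\times\mathbb R^{n,n}\times\mathbb R^{m,m}\times\mathbb R^{r,r}$ with $\Gamma,R,Q$ symmetric positive definite, the associated Kalman filter $\widehat x$ with error covariance $\Pi$ is given by $$\dot\Pi=A\Pi+\Pi A^\top-\Pi C^\top Q^{-1}C\Pi+BRB^\top \text{ on }(0,T),\quad \Pi(0)=\Gamma,$$ $$\dot{\widehat x}=A\widehat x+\Pi C^\top Q^{-1}(y-C\widehat x)\text{ on }(0,T),\quad \widehat x(0)=x_0 .$$ Put $\|\mathcal S\|_1=\|A\|+\|\Gamma\|+\|R\|+\|Q\|$ with the spectral norm, and $\|v\|_P=\sqrt{v^\top Pv}$. An uncertainty model consists of functions $a,\gamma,\rho,q$ on $\mathbb R^{s_A},\mathbb R^{s_\Gamma},\mathbb R^{s_R},\mathbb R^{s_Q}$ with values in $\mathbb R^{n,n},\mathbb R^{n,n},\mathbb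 R^{m,m},\mathbb R^{r,r}$, and non-empty finite sets $\Sigma_A,\Sigma_\Gamma,\Sigma_R,\Sigma_Q$ of parameters in these spaces, such that $\gamma,\rho,q$ are symmetric positive definite on $\Sigma_\Gamma,\Sigma_R,\Sigma_Q$. The set $\Sigma=\Sigma_A\times\Sigma_\Gamma\times\Sigma_R\times\Sigma_Q$, of cardinality $N$, carries the uniform probability, $\mathbb E[X_\sigma]=\frac1N\sum_{\sigma\in\Sigma}X_\sigma$, and $\mathcal S_\sigma=(A_\sigma,\Gamma_\sigma,R_\sigma,Q_\sigma)=(a(\sigma_A),\gamma(\sigma_\Gamma),\rho(\sigma_R),q(\sigma_Q))$. Let $\mathcal S_{\mathbb E}=(A_{\mathbb E},\Gamma_{\mathbb E},R_{\mathbb E},Q_{\mathbb E})$ be the tuple of expectations of these matrices. Let $\widehat x_{\mathbb E}$ be the Kalman filter associated with $\mathcal S_{\mathbb E}$ and, for $\bar\sigma\in\Sigma$, let $\widehat x_{\bar\sigma}$ be the Kalman filter associated with $\mathcal S_{\bar\sigma}$, $\Pi_{\bar\sigma}$ its error covariance and $P_{\bar\sigma}(t)=\Pi_{\bar\sigma}(t)^{-1}$.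 Then for every $M$ there is a constant $c_{\mathbb E}>0$, depending only on $T,B,C,x_0,y$ and $M$ (in particular independent of $N$), such that for every uncertainty model and every $\bar\sigma\in\Sigma$ for which the spectral norms of the matrices $A,\Gamma,R,Q,Q^{-1}$ of both $\mathcal S_{\mathbb E}$ and $\mathcal S_{\bar\sigma}$, and of $\Gamma_{\bar\sigma}^{-1}$, are at most $M$, and for all $t\in[0,T]$, $$\|\widehat x_{\mathbb E}(t)-\widehat x_{\bar\sigma}(t)\|_{P_{\bar\sigma}(t)}\le c_{\mathbb E}\,\mathbb E\big[\|\mathcal S_\sigma-\mathcal S_{\bar\sigma}\|_1\big].$$ -/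

import Mathlib

open MeasureTheory Matrix
open scoped Matrix.Norms.L2Operator

noncomputable section

/-- The four-tuple `S = (A, Γ, R, Q)` of system matrix and covariance matrices. Throughout, `‖·‖`
on matrices is the spectral norm (the operator norm induced by the Euclidean norms). -/
@[ext]
structure FilterData (n m r : ℕ) where
  A : Matrix (Fin n) (Fin n) ℝ
  Γ : Matrix (Fin n) (Fin n) ℝ
  R : Matrix (Fin m) (Fin m) ℝ
  Q : Matrix (Fin r) (Fin r) ℝ

namespace FilterData

variable {n m r : ℕ}

/-- Differences of four-tuples are componentwise. -/
instance : Sub (FilterData n m r) where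
  sub S S' := ⟨S.A - S'.A, S.Γ - S'.Γ, S.R - S'.R, S.Q - S'.Q⟩

/-- `‖S‖₁ = ‖A‖ + ‖Γ‖ + ‖R‖ + ‖Q‖`. -/
def norm1 (S : FilterData n m r) : ℝ := ‖S.A‖ + ‖S.Γ‖ + ‖S.R‖ + ‖S.Q‖

/-- `M` bounds the four matrices of `S` and the inverse of `Q`. -/
structure BoundedBy (S : FilterData n m r) (M : ℝ) : Prop where
  A_le : ‖S.A‖ ≤ M
  Γ_le : ‖S.Γ‖ ≤ M
  R_le : ‖S.R‖ ≤ M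
  Q_le : ‖S.Q‖ ≤ M
  Qinv_le : ‖S.Q⁻¹‖ ≤ M

end FilterData

/-- `Pi` (written `Π` below) solves the differential Riccati equation of the error covariance on `[0, T]`:
`Π' = A Π + Π Aᵀ - Π Cᵀ Q⁻¹ C Π + B R Bᵀ` on `(0, T)`, `Π(0) = Γ`. -/
structure IsErrorCovariance {n m r : ℕ} (T : ℝ)
    (B : Matrix (Fin n) (Fin m) ℝ) (C : Matrix (Fin r) (Fin n) ℝ)
    (S : FilterData n m r) (Pi : ℝ → Matrix (Fin n) (Fin n) ℝ) : Prop where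
  continuousOn : ContinuousOn Pi (Set.Icc 0 T)
  hasDerivAt : ∀ t ∈ Set.Ioo 0 T,
    HasDerivAt Pi (S.A * Pi t + Pi t * S.Aᵀ - Pi t * Cᵀ * S.Q⁻¹ * C * Pi t + B * S.R * Bᵀ) t
  initial : Pi 0 = S.Γ

/-- `x` is the Kalman filter trajectory on `[0, T]` for the data `S`, the output `y` and the error
covariance `Pi`: `x' = A x + Π Cᵀ Q⁻¹ (y - C x)` on `(0, T)`, `x(0) = x₀`. As `y` is only square
integrable, the (absolutely continuous) solution is expressed by the integrated equation. -/
structure IsKalmanTrajectory {n m r : ℕ} (T : ℝ)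
    (C : Matrix (Fin r) (Fin n) ℝ) (x₀ : Fin n → ℝ) (y : ℝ → Fin r → ℝ)
    (S : FilterData n m r) (Pi : ℝ → Matrix (Fin n) (Fin n) ℝ) (x : ℝ → Fin n → ℝ) : Prop where
  continuousOn : ContinuousOn x (Set.Icc 0 T)
  integral_eq : ∀ t ∈ Set.Icc 0 T,
    x t = x₀ + ∫ s in (0 : ℝ)..t, (S.A *ᵥ x s + (Pi s * Cᵀ * S.Q⁻¹) *ᵥ (y s - C *ᵥ x s))

/-- The weighted norm `‖v‖_P = √(vᵀ P v)`. -/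
def weightedNorm {n : ℕ} (P : Matrix (Fin n) (Fin n) ℝ) (v : Fin n → ℝ) : ℝ :=
  Real.sqrt (v ⬝ᵥ (P *ᵥ v))

/-- The uncertainty model: matrix valued functions of parameters in `ℝ^{s_A}`, `ℝ^{s_Γ}`,
`ℝ^{s_R}`, `ℝ^{s_Q}` and finite parameter sets, on which the covariance matrices are symmetric
positive definite. -/
structure UncertainModel (n m r : ℕ) where
  (sA sΓ sR sQ : ℕ)
  a : (Fin sA → ℝ) → Matrix (Fin n) (Fin n) ℝ
  γ : (Fin sΓ → ℝ) → Matrix (Fin n) (Fin n) ℝ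
  ρ : (Fin sR → ℝ) → Matrix (Fin m) (Fin m) ℝ
  q : (Fin sQ → ℝ) → Matrix (Fin r) (Fin r) ℝ
  SigmaA : Finset (Fin sA → ℝ)
  SigmaΓ : Finset (Fin sΓ → ℝ)
  SigmaR : Finset (Fin sR → ℝ)
  SigmaQ : Finset (Fin sQ → ℝ)
  γ_posDef : ∀ σ ∈ SigmaΓ, (γ σ).PosDef
  ρ_posDef : ∀ σ ∈ SigmaR, (ρ σ).PosDef
  q_posDef : ∀ σ ∈ SigmaQ, (q σ).PosDef

namespace UncertainModel

variable {n m r : ℕ} (U : UncertainModel n m r)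

/-- The space in which the joint parameter `σ = (σ_A, σ_Γ, σ_R, σ_Q)` lies. -/
abbrev Param : Type :=
  (Fin U.sA → ℝ) × (Fin U.sΓ → ℝ) × (Fin U.sR → ℝ) × (Fin U.sQ → ℝ)

/-- The finite set `Σ = Σ_A × Σ_Γ × Σ_R × Σ_Q` of joint parameters. -/
def Sigma : Finset U.Param := U.SigmaA ×ˢ U.SigmaΓ ×ˢ U.SigmaR ×ˢ U.SigmaQ

/-- The number `N` of joint parameters. -/
def N : ℕ := U.Sigma.card

/-- The expectation of a random variable on `Σ` under the uniform probability. -/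
def expectation {E : Type*} [AddCommMonoid E] [Module ℝ E] (X : U.Param → E) : E :=
  (U.N : ℝ)⁻¹ • ∑ σ ∈ U.Sigma, X σ

/-- The four-tuple `S_σ` that realizes with the parameter `σ`. -/
def data (σ : U.Param) : FilterData n m r :=
  ⟨U.a σ.1, U.γ σ.2.1, U.ρ σ.2.2.1, U.q σ.2.2.2⟩

/-- The four-tuple `(A_𝔼, Γ_𝔼, R_𝔼, Q_𝔼)` of averaged matrices. -/
def meanData : FilterData n m r where
  A := U.expectation fun σ => (U.data σ).A
  Γ := U.expectation fun σ => (U.data σ).Γ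
  R := U.expectation fun σ => (U.data σ).R
  Q := U.expectation fun σ => (U.data σ).Q

end UncertainModel

end

/-! ### Spectral norms and quadratic forms of real matrices. -/

section Euclidean

variable {k l : ℕ}

/-! On data bounded by `M`, the filter is a Lipschitz function of its four-tuple
(`exists_weightedNorm_sub_le`). Granting this, averaging costs nothing: the mean tuple is again
admissible, and the triangle inequality bounds its distance from the true tuple by the expected
distance (`norm1_meanData_sub_le`), without any factor `N`.

The Lipschitz property is Grönwall's inequality applied twice, to the error covariances and then to
the trajectories. The Riccati equation is quadratic, so its field is Lipschitz only on bounded sets;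
the work lies in bounds that depend on `M` alone. Symmetry of `Π` follows from uniqueness. A barrier
argument keeps `Π` above an exponentially decaying multiple of the identity
(`IsErrorCovariance.quadratic_ge`). Once `Π ≥ 0`, the quadratic Riccati term can be dropped from
upper estimates of `vᵀΠv`, so `‖Π‖` grows at most exponentially (`IsErrorCovariance.norm_le`).

The lower bound is used quantitatively only for the true tuple, where it turns the weight `Π⁻¹` into
a constant multiple of the Euclidean norm; this is where the bound on the inverse of the true `Γ`
enters. -/

theorem norm_toLp_sq (v : Fin k → ℝ) : ‖WithLp.toLp 2 v‖ ^ 2 = v ⬝ᵥ v := by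
  rw [EuclideanSpace.norm_sq_eq]
  simp [dotProduct, sq]

theorem dotProduct_self_nonneg_real (v : Fin k → ℝ) : 0 ≤ v ⬝ᵥ v := by
  rw [← norm_toLp_sq]
  positivity

theorem norm_toLp_mulVec_le (A : Matrix (Fin k) (Fin l) ℝ) (v : Fin l → ℝ) :
    ‖WithLp.toLp 2 (A *ᵥ v)‖ ≤ ‖A‖ * ‖WithLp.toLp 2 v‖ :=
  A.l2_opNorm_mulVec (WithLp.toLp 2 v)

theorem abs_dotProduct_mulVec_le (A : Matrix (Fin k) (Fin k) ℝ) (v : Fin k → ℝ) :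
    |v ⬝ᵥ (A *ᵥ v)| ≤ ‖A‖ * (v ⬝ᵥ v) := by
  have h := abs_real_inner_le_norm (WithLp.toLp 2 v) (WithLp.toLp 2 (A *ᵥ v))
  have h1 : inner ℝ (WithLp.toLp 2 v) (WithLp.toLp 2 (A *ᵥ v)) = v ⬝ᵥ (A *ᵥ v) := by
    rw [← Matrix.inner_toEuclideanCLM A (WithLp.toLp 2 v) (WithLp.toLp 2 v)]
    rfl
  rw [h1] at h
  rw [← norm_toLp_sq]
  have h2 := mul_le_mul_of_nonneg_left (norm_toLp_mulVec_le A v) (norm_nonneg (WithLp.toLp 2 v))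
  linarith

theorem matrix_norm_le_of_forall (A : Matrix (Fin k) (Fin l) ℝ) {c : ℝ} (hc : 0 ≤ c)
    (h : ∀ v, (A *ᵥ v) ⬝ᵥ (A *ᵥ v) ≤ c ^ 2 * (v ⬝ᵥ v)) : ‖A‖ ≤ c := by
  rw [Matrix.l2_opNorm_def]
  refine ContinuousLinearMap.opNorm_le_bound _ hc fun x => ?_
  have h1 := h x.ofLp
  rw [← norm_toLp_sq, ← norm_toLp_sq, ← mul_pow] at h1
  exact le_of_sq_le_sq h1 (by positivity)

theorem norm_transpose_eq (A : Matrix (Fin k) (Fin l) ℝ) : ‖Aᵀ‖ = ‖A‖ := by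
  rw [← conjTranspose_eq_transpose_of_trivial, l2_opNorm_conjTranspose]

theorem norm_toLp_le_sqrt_mul (v : Fin k → ℝ) : ‖WithLp.toLp 2 v‖ ≤ √k * ‖v‖ := by
  rw [EuclideanSpace.norm_eq]
  have : ∑ i, ‖(WithLp.toLp 2 v).ofLp i‖ ^ 2 ≤ k * ‖v‖ ^ 2 := by
    calc _ ≤ ∑ _i : Fin k, ‖v‖ ^ 2 := Finset.sum_le_sum fun i _ => by
          have := norm_le_pi_norm v i
          gcongr
      _ = _ := by simp
  calc _ ≤ √(k * ‖v‖ ^ 2) := Real.sqrt_le_sqrt this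
    _ = _ := by rw [Real.sqrt_mul (by positivity), Real.sqrt_sq (by positivity)]

theorem norm_le_norm_toLp (v : Fin k → ℝ) : ‖v‖ ≤ ‖WithLp.toLp 2 v‖ := by
  refine (pi_norm_le_iff_of_nonneg (norm_nonneg _)).2 fun i => ?_
  exact PiLp.norm_apply_le (WithLp.toLp 2 v) i

theorem norm_mulVec_le_sqrt (A : Matrix (Fin k) (Fin l) ℝ) (v : Fin l → ℝ) :
    ‖A *ᵥ v‖ ≤ √l * ‖A‖ * ‖v‖ := by
  have h1 := norm_le_norm_toLp (A *ᵥ v)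
  have h2 := norm_toLp_mulVec_le A v
  have h3 := mul_le_mul_of_nonneg_left (norm_toLp_le_sqrt_mul v) (norm_nonneg A)
  linarith

theorem dotProduct_mulVec_comm_of_symm {P : Matrix (Fin k) (Fin k) ℝ} (hP : Pᵀ = P)
    (v w : Fin k → ℝ) : v ⬝ᵥ (P *ᵥ w) = (P *ᵥ v) ⬝ᵥ w := by
  rw [dotProduct_mulVec, ← mulVec_transpose, hP]

/-- A symmetric matrix with `0 ≤ P ≤ c` has norm at most `c`. -/
theorem norm_le_of_quadratic_le {P : Matrix (Fin k) (Fin k) ℝ} (hP : Pᵀ = P) {c : ℝ} (hc : 0 < c)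
    (h0 : ∀ v, 0 ≤ v ⬝ᵥ (P *ᵥ v)) (h1 : ∀ v, v ⬝ᵥ (P *ᵥ v) ≤ c * (v ⬝ᵥ v)) : ‖P‖ ≤ c := by
  refine matrix_norm_le_of_forall P hc.le fun v => ?_
  -- Nonnegativity at `c v - P v`, with the upper bound at `P v`, gives `c |Pv|² ≤ c² vᵀPv`.
  have h2 := h0 (c • v - P *ᵥ v)
  have h3 := h1 (P *ᵥ v)
  have h4 := h1 v
  simp only [mulVec_sub, mulVec_smul, dotProduct_sub, sub_dotProduct, smul_dotProduct,
    dotProduct_smul, smul_eq_mul] at h2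
  rw [dotProduct_mulVec_comm_of_symm hP v (P *ᵥ v)] at h2
  have h5 := mul_le_mul_of_nonneg_left h4 (sq_nonneg c)
  have h6 : c * ((P *ᵥ v) ⬝ᵥ (P *ᵥ v)) ≤ c * (c ^ 2 * (v ⬝ᵥ v)) := by linarith
  exact le_of_mul_le_mul_left h6 hc

/-- A bound on the inverse of a positive definite matrix is a lower bound for the matrix. -/
theorem quadratic_ge_of_norm_inv_le {G : Matrix (Fin k) (Fin k) ℝ} (hG : G.PosDef) {M : ℝ}
    (hM : 0 < M) (h : ‖G⁻¹‖ ≤ M) (v : Fin k → ℝ) : M⁻¹ * (v ⬝ᵥ v) ≤ v ⬝ᵥ (G *ᵥ v) := by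
  have hs : Gᵀ = G := by
    rw [← conjTranspose_eq_transpose_of_trivial]
    exact hG.isHermitian
  have hu : G *ᵥ (G⁻¹ *ᵥ v) = v := by
    rw [mulVec_mulVec, Matrix.mul_nonsing_inv _ ((Matrix.isUnit_iff_isUnit_det _).1 hG.isUnit),
      one_mulVec]
  -- Expanding the form at this vector gives `vᵀGv ≥ 2M⁻¹|v|² - M⁻² vᵀG⁻¹v`, and the last term is at
  -- most `M⁻¹|v|²`.
  have h0 := hG.posSemidef.dotProduct_mulVec_nonneg (v - M⁻¹ • (G⁻¹ *ᵥ v))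
  have h1 := (le_abs_self _).trans (abs_dotProduct_mulVec_le G⁻¹ v)
  have h1' : v ⬝ᵥ (G⁻¹ *ᵥ v) ≤ M * (v ⬝ᵥ v) :=
    h1.trans (mul_le_mul_of_nonneg_right h (dotProduct_self_nonneg_real v))
  simp only [star_trivial, mulVec_sub, mulVec_smul, dotProduct_sub, sub_dotProduct, smul_dotProduct,
    dotProduct_smul, smul_eq_mul, hu] at h0
  rw [dotProduct_mulVec_comm_of_symm hs (G⁻¹ *ᵥ v) v, hu, dotProduct_comm (G⁻¹ *ᵥ v) v] at h0
  have h2 : M⁻¹ * (M⁻¹ * (v ⬝ᵥ (G⁻¹ *ᵥ v))) ≤ M⁻¹ * (v ⬝ᵥ v) := by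
    refine mul_le_mul_of_nonneg_left ?_ (inv_nonneg.2 hM.le)
    rwa [inv_mul_le_iff₀ hM]
  linarith

/-- With `u = P⁻¹v` the hypothesis reads `e|u|² ≤ uᵀv`; inserting this into `|v - e u|² ≥ 0` leaves
`e uᵀv ≤ |v|²`. -/
theorem inv_quadratic_le {P : Matrix (Fin k) (Fin k) ℝ} (hP : P.PosDef) {e : ℝ}
    (he : 0 < e) (h : ∀ v, e * (v ⬝ᵥ v) ≤ v ⬝ᵥ (P *ᵥ v)) (v : Fin k → ℝ) :
    v ⬝ᵥ (P⁻¹ *ᵥ v) ≤ e⁻¹ * (v ⬝ᵥ v) := by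
  have hu : P *ᵥ (P⁻¹ *ᵥ v) = v := by
    rw [mulVec_mulVec, Matrix.mul_nonsing_inv _ ((Matrix.isUnit_iff_isUnit_det _).1 hP.isUnit),
      one_mulVec]
  have h1 := h (P⁻¹ *ᵥ v)
  rw [hu, dotProduct_comm _ v] at h1
  have h2 := dotProduct_self_nonneg_real (v - e • (P⁻¹ *ᵥ v))
  simp only [dotProduct_sub, sub_dotProduct, smul_dotProduct,
    dotProduct_smul, smul_eq_mul] at h2
  rw [dotProduct_comm (P⁻¹ *ᵥ v) v] at h2
  have h3 := mul_le_mul_of_nonneg_left h1 he.le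
  rw [inv_mul_eq_div, le_div_iff₀ he]
  linarith

end Euclidean

/-- Grönwall's inequality in integral form. -/
theorem le_mul_exp_of_le_integral {T a K : ℝ} (hK : 0 ≤ K) {u h : ℝ → ℝ}
    (hu : ContinuousOn u (Set.Icc 0 T)) (hint : IntervalIntegrable h volume 0 T)
    (hh : ∀ s ∈ Set.Icc 0 T, 0 ≤ h s)
    (hle : ∀ t ∈ Set.Icc 0 T, u t ≤ a + ∫ s in (0 : ℝ)..t, (K * u s + h s)) :
    ∀ t ∈ Set.Icc 0 T, u t ≤ (a + ∫ s in (0 : ℝ)..T, h s) * Real.exp (K * t) := by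
  intro t ht
  have hT : 0 ≤ T := ht.1.trans ht.2
  set b := a + ∫ s in (0 : ℝ)..T, h s with hb
  have huint : IntervalIntegrable u volume 0 T :=
    (by rwa [Set.uIcc_of_le hT] : ContinuousOn u (Set.uIcc 0 T)).intervalIntegrable
  have hsub : ∀ t ∈ Set.Icc 0 T, Set.uIcc 0 t ⊆ Set.uIcc 0 T := fun t ht => by
    rw [Set.uIcc_of_le ht.1, Set.uIcc_of_le hT]
    exact Set.Icc_subset_Icc_right ht.2
  have hsub' : ∀ t ∈ Set.Icc 0 T, Set.uIcc t T ⊆ Set.uIcc 0 T := fun t ht => by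
    rw [Set.uIcc_of_le ht.2, Set.uIcc_of_le hT]
    exact Set.Icc_subset_Icc_left ht.1
  -- As `h ≥ 0`, its integral may be extended to all of `[0, T]` and absorbed into the constant `b`.
  have hle' : ∀ t ∈ Set.Icc 0 T, u t ≤ b + K * ∫ s in (0 : ℝ)..t, u s := by
    intro t ht
    have h1 := hint.mono_set (hsub t ht)
    have h2 := huint.mono_set (hsub t ht)
    have h3 := hle t ht
    rw [intervalIntegral.integral_add (h2.const_mul K) h1, intervalIntegral.integral_const_mul] at h3
    have h4 := intervalIntegral.integral_add_adjacent_intervals h1 (hint.mono_set (hsub' t ht))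
    have h5 : 0 ≤ ∫ s in t..T, h s := intervalIntegral.integral_nonneg ht.2
      fun s hs => hh s ⟨ht.1.trans hs.1, hs.2⟩
    linarith
  let g : ℝ → ℝ := fun t => b + K * ∫ s in (0 : ℝ)..t, u s
  have hgc : ContinuousOn g (Set.Icc 0 T) := by
    have := intervalIntegral.continuousOn_primitive_interval (μ := volume) (f := u) (a := 0) (b := T)
      (by rw [Set.uIcc_of_le hT]; exact hu.integrableOn_Icc)
    rw [Set.uIcc_of_le hT] at this
    exact continuousOn_const.add (continuousOn_const.mul this)
  have hgd : ∀ t ∈ Set.Ioo 0 T, HasDerivAt g (K * u t) t := by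
    intro t ht
    have hmem : Set.Icc 0 T ∈ nhds t := Icc_mem_nhds ht.1 ht.2
    have h1 := intervalIntegral.integral_hasDerivAt_right
      (huint.mono_set (hsub t ⟨ht.1.le, ht.2.le⟩))
      ((hu.stronglyMeasurableAtFilter_nhdsWithin measurableSet_Icc t).filter_mono
        (by rw [nhdsWithin_eq_nhds.2 hmem])) (hu.continuousAt hmem)
    exact (h1.const_mul K).const_add b
  have hed : ∀ t, HasDerivAt (fun t => Real.exp (-(K * t))) (Real.exp (-(K * t)) * -(K * 1)) t :=
    fun t => (((hasDerivAt_id t).const_mul K).neg).exp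
  have hd : ∀ t ∈ Set.Ioo 0 T, HasDerivAt (fun t => g t * Real.exp (-(K * t)))
      (K * u t * Real.exp (-(K * t)) + g t * (Real.exp (-(K * t)) * -(K * 1))) t :=
    fun t ht => (hgd t ht).mul (hed t)
  -- Integrating factor: the derivative is `K exp(-Kt) (u - g)`, nonpositive since `u ≤ g`.
  have hanti : AntitoneOn (fun t => g t * Real.exp (-(K * t))) (Set.Icc 0 T) := by
    refine antitoneOn_of_deriv_nonpos (convex_Icc 0 T) (hgc.mul (by fun_prop)) ?_ ?_
    · rw [interior_Icc]
      exact fun t ht => (hd t ht).differentiableAt.differentiableWithinAt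
    · rw [interior_Icc]
      intro t ht
      rw [(hd t ht).deriv]
      have h1 := mul_le_mul_of_nonneg_left (hle' t ⟨ht.1.le, ht.2.le⟩)
        (mul_nonneg hK (Real.exp_pos (-(K * t))).le)
      change _ ≤ K * Real.exp (-(K * t)) * g t at h1
      linarith
  have h1 := hanti ⟨le_rfl, hT⟩ ht ht.1
  have h2 : g 0 = b := by simp [g]
  simp only [h2, mul_zero, neg_zero, Real.exp_zero, mul_one, Real.exp_neg] at h1
  rw [← div_eq_mul_inv, div_le_iff₀ (Real.exp_pos _)] at h1
  exact (hle' t ht).trans h1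

/-! ### Lipschitz dependence and symmetry for the Riccati equation. -/

section Riccati

variable {n m r : ℕ} {T : ℝ} {B : Matrix (Fin n) (Fin m) ℝ} {C : Matrix (Fin r) (Fin n) ℝ}

/-- The right-hand side of the differential Riccati equation. -/
noncomputable def riccatiField (B : Matrix (Fin n) (Fin m) ℝ) (C : Matrix (Fin r) (Fin n) ℝ)
    (S : FilterData n m r) (P : Matrix (Fin n) (Fin n) ℝ) : Matrix (Fin n) (Fin n) ℝ :=
  S.A * P + P * S.Aᵀ - P * Cᵀ * S.Q⁻¹ * C * P + B * S.R * Bᵀ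

theorem continuous_riccatiField (S : FilterData n m r) : Continuous (riccatiField B C S) := by
  unfold riccatiField
  fun_prop

theorem norm_mul_mul_le {a b c d : ℕ} (X : Matrix (Fin a) (Fin b) ℝ) (Y : Matrix (Fin b) (Fin c) ℝ)
    (Z : Matrix (Fin c) (Fin d) ℝ) : ‖X * Y * Z‖ ≤ ‖X‖ * ‖Y‖ * ‖Z‖ :=
  (l2_opNorm_mul _ _).trans (mul_le_mul_of_nonneg_right (l2_opNorm_mul _ _) (norm_nonneg _))

theorem IsErrorCovariance.integral_eq {S : FilterData n m r}
    {Pi : ℝ → Matrix (Fin n) (Fin n) ℝ} (h : IsErrorCovariance T B C S Pi) :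
    ∀ t ∈ Set.Icc 0 T, IntervalIntegrable (fun s => riccatiField B C S (Pi s)) volume 0 t ∧
      ∫ s in (0 : ℝ)..t, riccatiField B C S (Pi s) = Pi t - S.Γ := by
  intro t ht
  have hc : ContinuousOn Pi (Set.Icc 0 t) := h.continuousOn.mono (Set.Icc_subset_Icc_right ht.2)
  have hi : IntervalIntegrable (fun s => riccatiField B C S (Pi s)) volume 0 t := by
    apply ContinuousOn.intervalIntegrable
    rw [Set.uIcc_of_le ht.1]
    exact (continuous_riccatiField S).comp_continuousOn hc
  refine ⟨hi, ?_⟩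
  have hd : ∀ s ∈ Set.Ioo 0 t, HasDerivAt Pi (riccatiField B C S (Pi s)) s :=
    fun s hs => h.hasDerivAt s ⟨hs.1, hs.2.trans_le ht.2⟩
  rw [intervalIntegral.integral_eq_sub_of_hasDerivAt_of_le ht.1 hc hd hi, h.initial]

theorem nonsing_inv_sub_nonsing_inv {k : ℕ} {X Y : Matrix (Fin k) (Fin k) ℝ} (hX : IsUnit X)
    (hY : IsUnit Y) : X⁻¹ - Y⁻¹ = X⁻¹ * (Y - X) * Y⁻¹ := by
  rw [Matrix.isUnit_iff_isUnit_det] at hX hY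
  rw [Matrix.mul_sub, Matrix.nonsing_inv_mul _ hX, Matrix.sub_mul, Matrix.mul_assoc,
    Matrix.mul_nonsing_inv _ hY, Matrix.mul_one, Matrix.one_mul]

theorem FilterData.norm1_nonneg (S : FilterData n m r) : 0 ≤ S.norm1 := by
  unfold FilterData.norm1
  positivity

theorem FilterData.norm_sub_le_norm1 (S S' : FilterData n m r) :
    ‖S.A - S'.A‖ ≤ (S - S').norm1 ∧ ‖S.Γ - S'.Γ‖ ≤ (S - S').norm1 ∧
    ‖S.R - S'.R‖ ≤ (S - S').norm1 ∧ ‖S.Q - S'.Q‖ ≤ (S - S').norm1 := by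
  have h : (S - S').norm1 = ‖S.A - S'.A‖ + ‖S.Γ - S'.Γ‖ + ‖S.R - S'.R‖ + ‖S.Q - S'.Q‖ := rfl
  have h1 := norm_nonneg (S.A - S'.A)
  have h2 := norm_nonneg (S.Γ - S'.Γ)
  have h3 := norm_nonneg (S.R - S'.R)
  have h4 := norm_nonneg (S.Q - S'.Q)
  refine ⟨?_, ?_, ?_, ?_⟩ <;> linarith

theorem FilterData.norm_inv_sub_inv_le {S S' : FilterData n m r} {M : ℝ} (hM : 0 ≤ M)
    (hS : S.BoundedBy M) (hS' : S'.BoundedBy M) (hQ : IsUnit S.Q) (hQ' : IsUnit S'.Q) :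
    ‖S.Q⁻¹ - S'.Q⁻¹‖ ≤ M ^ 2 * (S - S').norm1 := by
  rw [nonsing_inv_sub_nonsing_inv hQ hQ']
  have h1 := (FilterData.norm_sub_le_norm1 S S').2.2.2
  rw [norm_sub_rev] at h1
  calc _ ≤ ‖S.Q⁻¹‖ * ‖S'.Q - S.Q‖ * ‖S'.Q⁻¹‖ := norm_mul_mul_le _ _ _
    _ ≤ M * (S - S').norm1 * M := by
        have := hS.Qinv_le
        have := hS'.Qinv_le
        have := FilterData.norm1_nonneg (S - S')
        gcongr
    _ = _ := by ring

theorem norm_riccatiField_sub_le {S S' : FilterData n m r} {M K : ℝ} (hM : 0 ≤ M) (hK : 0 ≤ K)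
    (hS : S.BoundedBy M) (hS' : S'.BoundedBy M) (hQ : IsUnit S.Q) (hQ' : IsUnit S'.Q)
    {P P' : Matrix (Fin n) (Fin n) ℝ} (hP : ‖P‖ ≤ K) (hP' : ‖P'‖ ≤ K) :
    ‖riccatiField B C S P - riccatiField B C S' P'‖ ≤
      (2 * M + 2 * (K * (‖C‖ * M * ‖C‖))) * ‖P - P'‖ +
      (2 * K + K ^ 2 * ‖C‖ ^ 2 * M ^ 2 + ‖B‖ ^ 2) * (S - S').norm1 := by
  -- Telescoping: each summand contains exactly one difference, of `P` or of the data.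
  have e : riccatiField B C S P - riccatiField B C S' P' =
      (S.A - S'.A) * P + S'.A * (P - P') + P * (S.A - S'.A)ᵀ + (P - P') * S'.Aᵀ
      - (P - P') * (Cᵀ * S.Q⁻¹ * C) * P - P' * (Cᵀ * (S.Q⁻¹ - S'.Q⁻¹) * C) * P
      - P' * (Cᵀ * S'.Q⁻¹ * C) * (P - P') + B * (S.R - S'.R) * Bᵀ := by
    simp only [riccatiField, Matrix.mul_sub, Matrix.sub_mul, Matrix.mul_assoc, transpose_sub]
    abel
  obtain ⟨hA, -, hR, -⟩ := FilterData.norm_sub_le_norm1 S S'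
  have hI := FilterData.norm_inv_sub_inv_le hM hS hS' hQ hQ'
  have hδ := FilterData.norm1_nonneg (S - S')
  have hq := hS.Qinv_le
  have hq' := hS'.Qinv_le
  have ha' := hS'.A_le
  set δ := (S - S').norm1
  have h1 : ‖(S.A - S'.A) * P‖ ≤ δ * K := (l2_opNorm_mul _ _).trans (by gcongr)
  have h2 : ‖S'.A * (P - P')‖ ≤ M * ‖P - P'‖ := (l2_opNorm_mul _ _).trans (by gcongr)
  have h3 : ‖P * (S.A - S'.A)ᵀ‖ ≤ K * δ :=
    (l2_opNorm_mul _ _).trans (by rw [norm_transpose_eq]; gcongr)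
  have h4 : ‖(P - P') * S'.Aᵀ‖ ≤ ‖P - P'‖ * M :=
    (l2_opNorm_mul _ _).trans (by rw [norm_transpose_eq]; gcongr)
  have hG : ∀ X : Matrix (Fin r) (Fin r) ℝ, ‖Cᵀ * X * C‖ ≤ ‖C‖ * ‖X‖ * ‖C‖ := fun X =>
    (norm_mul_mul_le _ _ _).trans (by rw [norm_transpose_eq])
  have h5 : ‖(P - P') * (Cᵀ * S.Q⁻¹ * C) * P‖ ≤ ‖P - P'‖ * (‖C‖ * M * ‖C‖) * K :=
    (norm_mul_mul_le _ _ _).trans (by grw [hG, hq, hP])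
  have h6 : ‖P' * (Cᵀ * (S.Q⁻¹ - S'.Q⁻¹) * C) * P‖ ≤ K * (‖C‖ * (M ^ 2 * δ) * ‖C‖) * K :=
    (norm_mul_mul_le _ _ _).trans (by grw [hG, hI, hP, hP'])
  have h7 : ‖P' * (Cᵀ * S'.Q⁻¹ * C) * (P - P')‖ ≤ K * (‖C‖ * M * ‖C‖) * ‖P - P'‖ :=
    (norm_mul_mul_le _ _ _).trans (by grw [hG, hq', hP'])
  have h8 : ‖B * (S.R - S'.R) * Bᵀ‖ ≤ ‖B‖ * δ * ‖B‖ :=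
    (norm_mul_mul_le _ _ _).trans (by rw [norm_transpose_eq]; gcongr)
  rw [e]
  refine (norm_add_le_of_le (norm_sub_le_of_le (norm_sub_le_of_le (norm_sub_le_of_le
    (norm_add_le_of_le (norm_add_le_of_le (norm_add_le_of_le h1 h2) h3) h4) h5) h6) h7) h8).trans ?_
  apply le_of_eq
  ring

/-- The error covariance depends Lipschitz continuously on the data. -/
theorem IsErrorCovariance.norm_sub_le {S S' : FilterData n m r} {M K : ℝ} (hT : 0 ≤ T)
    (hM : 0 ≤ M) (hK : 0 ≤ K)
    (hS : S.BoundedBy M) (hS' : S'.BoundedBy M) (hQ : IsUnit S.Q) (hQ' : IsUnit S'.Q)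
    {P P' : ℝ → Matrix (Fin n) (Fin n) ℝ} (h : IsErrorCovariance T B C S P)
    (h' : IsErrorCovariance T B C S' P')
    (hP : ∀ t ∈ Set.Icc 0 T, ‖P t‖ ≤ K) (hP' : ∀ t ∈ Set.Icc 0 T, ‖P' t‖ ≤ K) :
    ∀ t ∈ Set.Icc 0 T, ‖P t - P' t‖ ≤
      ((1 + T * (2 * K + K ^ 2 * ‖C‖ ^ 2 * M ^ 2 + ‖B‖ ^ 2)) *
        Real.exp ((2 * M + 2 * (K * (‖C‖ * M * ‖C‖))) * T)) * (S - S').norm1 := by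
  intro t ht
  have hδ := FilterData.norm1_nonneg (S - S')
  set δ := (S - S').norm1 with hδdef
  set L := 2 * M + 2 * (K * (‖C‖ * M * ‖C‖)) with hL
  set κ := 2 * K + K ^ 2 * ‖C‖ ^ 2 * M ^ 2 + ‖B‖ ^ 2 with hκ
  have hL0 : 0 ≤ L := by positivity
  have hκ0 : 0 ≤ κ := by positivity
  have hc : ContinuousOn (fun s => ‖P s - P' s‖) (Set.Icc 0 T) :=
    (h.continuousOn.sub h'.continuousOn).norm
  have key := le_mul_exp_of_le_integral (T := T) (a := δ) hL0 (u := fun s => ‖P s - P' s‖)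
    (h := fun _ => κ * δ) hc intervalIntegrable_const (fun _ _ => by positivity) (by
      intro s hs
      obtain ⟨i1, e1⟩ := h.integral_eq s hs
      obtain ⟨i2, e2⟩ := h'.integral_eq s hs
      have e3 : P s - P' s = (S.Γ - S'.Γ) +
          ∫ τ in (0 : ℝ)..s, (riccatiField B C S (P τ) - riccatiField B C S' (P' τ)) := by
        rw [intervalIntegral.integral_sub i1 i2, e1, e2]
        abel
      rw [e3]
      refine norm_add_le_of_le (FilterData.norm_sub_le_norm1 S S').2.1 ?_
      refine intervalIntegral.norm_integral_le_of_norm_le hs.1 (ae_of_all _ fun τ hτ => ?_) ?_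
      · have hτ' : τ ∈ Set.Icc 0 T := ⟨hτ.1.le, hτ.2.trans hs.2⟩
        exact norm_riccatiField_sub_le hM hK hS hS' hQ hQ' (hP τ hτ') (hP' τ hτ')
      · apply ContinuousOn.intervalIntegrable
        rw [Set.uIcc_of_le hs.1]
        exact ((hc.mono (Set.Icc_subset_Icc_right hs.2)).const_smul L).add continuousOn_const)
    t ht
  simp only [intervalIntegral.integral_const, smul_eq_mul, sub_zero] at key
  refine key.trans ?_
  have h1 : Real.exp (L * t) ≤ Real.exp (L * T) :=
    Real.exp_le_exp.2 (mul_le_mul_of_nonneg_left ht.2 hL0)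
  calc (δ + T * (κ * δ)) * Real.exp (L * t) ≤ (δ + T * (κ * δ)) * Real.exp (L * T) := by gcongr
    _ = _ := by ring

/-- For symmetric data `Πᵀ` solves the same initial value problem, and the Lipschitz estimate with
both data equal is a uniqueness statement. The bounds it needs may be arbitrary here, so compactness
suffices. -/
theorem IsErrorCovariance.transpose_eq {S : FilterData n m r} (hT : 0 ≤ T)
    (hΓ : S.Γᵀ = S.Γ) (hR : S.Rᵀ = S.R) (hQ : S.Qᵀ = S.Q) (hQu : IsUnit S.Q)
    {P : ℝ → Matrix (Fin n) (Fin n) ℝ} (h : IsErrorCovariance T B C S P) :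
    ∀ t ∈ Set.Icc 0 T, (P t)ᵀ = P t := by
  have h' : IsErrorCovariance T B C S (fun t => (P t)ᵀ) := by
    refine ⟨(continuous_id.matrix_transpose).comp_continuousOn h.continuousOn, fun t ht => ?_, ?_⟩
    · have h1 := h.hasDerivAt t ht
      have h2 := ((transposeLinearEquiv (Fin n) (Fin n) ℝ ℝ).toLinearMap.toContinuousLinearMap
        ).hasFDerivAt.comp_hasDerivAt t h1
      refine HasDerivAt.congr_deriv h2 ?_
      change (S.A * P t + P t * S.Aᵀ - P t * Cᵀ * S.Q⁻¹ * C * P t + B * S.R * Bᵀ)ᵀ = _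
      simp only [transpose_add, transpose_sub, transpose_mul, transpose_transpose, hR,
        transpose_nonsing_inv, hQ, Matrix.mul_assoc]
      abel
    · simp only [h.initial, hΓ]
  obtain ⟨K, hK⟩ := isCompact_Icc.exists_bound_of_continuousOn h.continuousOn
  obtain ⟨M, hM⟩ : ∃ M : ℝ, S.BoundedBy M :=
    ⟨‖S.A‖ + ‖S.Γ‖ + ‖S.R‖ + ‖S.Q‖ + ‖S.Q⁻¹‖, by
      have := norm_nonneg S.A
      have := norm_nonneg S.Γ
      have := norm_nonneg S.R
      have := norm_nonneg S.Q
      have := norm_nonneg S.Q⁻¹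
      constructor <;> linarith⟩
  intro t ht
  have h0 : (S - S).norm1 = 0 := by
    change ‖S.A - S.A‖ + ‖S.Γ - S.Γ‖ + ‖S.R - S.R‖ + ‖S.Q - S.Q‖ = 0
    simp
  have key := h'.norm_sub_le hT ((norm_nonneg _).trans hM.A_le)
    ((norm_nonneg _).trans (hK t ht)) hM hM hQu hQu h
    (fun s hs => by rw [norm_transpose_eq]; exact hK s hs) hK t ht
  rw [h0, mul_zero] at key
  exact sub_eq_zero.1 (norm_le_zero_iff.1 key)

end Riccati

/-! ### Lower and upper bounds for the error covariance. -/

section Bounds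

variable {n m r : ℕ} {T : ℝ} {B : Matrix (Fin n) (Fin m) ℝ} {C : Matrix (Fin r) (Fin n) ℝ}

theorem quadratic_ge_of_unit {k : ℕ} {P : Matrix (Fin k) (Fin k) ℝ} {c : ℝ}
    (h : ∀ w, w ⬝ᵥ w = 1 → c ≤ w ⬝ᵥ (P *ᵥ w)) (v : Fin k → ℝ) :
    c * (v ⬝ᵥ v) ≤ v ⬝ᵥ (P *ᵥ v) := by
  by_cases hv : v = 0
  · simp [hv]
  have hpos : 0 < v ⬝ᵥ v := lt_of_le_of_ne (dotProduct_self_nonneg_real v)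
    fun h => hv (dotProduct_self_eq_zero.1 h.symm)
  have hs := Real.mul_self_sqrt hpos.le
  have hs0 : 0 < √(v ⬝ᵥ v) := Real.sqrt_pos.2 hpos
  have h1 := h ((√(v ⬝ᵥ v))⁻¹ • v) (by
    simp only [smul_dotProduct, dotProduct_smul, smul_eq_mul]
    rw [← mul_assoc, ← mul_inv, hs, inv_mul_cancel₀ hpos.ne'])
  simp only [mulVec_smul, smul_dotProduct, dotProduct_smul, smul_eq_mul] at h1
  rwa [← mul_assoc, ← mul_inv, hs, inv_mul_eq_div, le_div_iff₀ hpos] at h1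

theorem isCompact_dotProduct_self_eq_one (k : ℕ) :
    IsCompact {v : Fin k → ℝ | v ⬝ᵥ v = 1} := by
  refine (isCompact_closedBall (0 : Fin k → ℝ) 1).of_isClosed_subset
    (isClosed_eq (by fun_prop) continuous_const) fun v hv => ?_
  rw [mem_closedBall_zero_iff]
  have h1 := norm_le_norm_toLp v
  have h2 := norm_toLp_sq v
  rw [show v ⬝ᵥ v = 1 from hv] at h2
  nlinarith [norm_nonneg (WithLp.toLp 2 v)]

/-- The evaluation of the quadratic form of a matrix, as a continuous linear map of the matrix. -/
noncomputable def quadraticCLM {k : ℕ} (v : Fin k → ℝ) : Matrix (Fin k) (Fin k) ℝ →L[ℝ] ℝ :=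
  LinearMap.toContinuousLinearMap
    { toFun := fun P => v ⬝ᵥ (P *ᵥ v)
      map_add' := fun P P' => by rw [add_mulVec, dotProduct_add]
      map_smul' := fun c P => by rw [smul_mulVec, dotProduct_smul]; rfl }

theorem quadraticCLM_apply {k : ℕ} (v : Fin k → ℝ) (P : Matrix (Fin k) (Fin k) ℝ) :
    quadraticCLM v P = v ⬝ᵥ (P *ᵥ v) := rfl

/-- Symmetry merges the two `A`-terms and isolates the quadratic term as a form in `C P v`. The
upper bound discards it by sign; the barrier argument estimates it at an eigenvector. -/
theorem dotProduct_riccatiField {S : FilterData n m r} {P : Matrix (Fin n) (Fin n) ℝ}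
    (hP : Pᵀ = P) (v : Fin n → ℝ) :
    v ⬝ᵥ (riccatiField B C S P *ᵥ v) = 2 * (v ⬝ᵥ (S.A *ᵥ (P *ᵥ v)))
      - (C *ᵥ (P *ᵥ v)) ⬝ᵥ (S.Q⁻¹ *ᵥ (C *ᵥ (P *ᵥ v)))
      + (Bᵀ *ᵥ v) ⬝ᵥ (S.R *ᵥ (Bᵀ *ᵥ v)) := by
  have h1 : v ⬝ᵥ (P *ᵥ (S.Aᵀ *ᵥ v)) = v ⬝ᵥ (S.A *ᵥ (P *ᵥ v)) := by
    rw [dotProduct_mulVec_comm_of_symm hP, dotProduct_mulVec, ← mulVec_transpose,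
      transpose_transpose, dotProduct_comm]
  have h2 : ∀ w : Fin r → ℝ, v ⬝ᵥ (P *ᵥ (Cᵀ *ᵥ w)) = (C *ᵥ (P *ᵥ v)) ⬝ᵥ w := fun w => by
    rw [dotProduct_mulVec_comm_of_symm hP, dotProduct_mulVec, ← mulVec_transpose,
      transpose_transpose]
  have h3 : ∀ w : Fin m → ℝ, v ⬝ᵥ (B *ᵥ w) = (Bᵀ *ᵥ v) ⬝ᵥ w := fun w => by
    rw [dotProduct_mulVec, ← mulVec_transpose]
  simp only [riccatiField, add_mulVec, sub_mulVec, dotProduct_add, dotProduct_sub,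
    ← mulVec_mulVec, h1, h2, h3]
  ring

theorem dotProduct_mulVec_self_le {k l : ℕ} (D : Matrix (Fin k) (Fin l) ℝ) (v : Fin l → ℝ) :
    (D *ᵥ v) ⬝ᵥ (D *ᵥ v) ≤ ‖D‖ ^ 2 * (v ⬝ᵥ v) := by
  rw [← norm_toLp_sq, ← norm_toLp_sq, ← mul_pow]
  exact pow_le_pow_left₀ (norm_nonneg _) (norm_toLp_mulVec_le D v) 2

/-- The error covariance stays uniformly positive definite: it remains above the exponentially
decreasing barrier `e / 2 * exp (-L t)`. -/
theorem IsErrorCovariance.quadratic_ge {S : FilterData n m r} {M e : ℝ} (hT : 0 < T)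
    (hA : ‖S.A‖ ≤ M) (hQ : ‖S.Q⁻¹‖ ≤ M) (hR : S.R.PosSemidef) (he : 0 < e) (he1 : e ≤ 1)
    (hΓ : ∀ v, e * (v ⬝ᵥ v) ≤ v ⬝ᵥ (S.Γ *ᵥ v)) {P : ℝ → Matrix (Fin n) (Fin n) ℝ}
    (h : IsErrorCovariance T B C S P) (hs : ∀ t ∈ Set.Icc 0 T, (P t)ᵀ = P t) :
    ∀ t ∈ Set.Icc 0 T, ∀ v, e / 2 * Real.exp (-((2 * M + M * ‖C‖ ^ 2 + 1) * t)) * (v ⬝ᵥ v) ≤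
      v ⬝ᵥ (P t *ᵥ v) := by
  have hM : 0 ≤ M := (norm_nonneg _).trans hA
  -- The first two terms offset the largest possible decay rate at a touching point, and the `1`
  -- makes the inequality there strict.
  set L := 2 * M + M * ‖C‖ ^ 2 + 1 with hL
  have hL0 : 0 ≤ L := by positivity
  -- The factor `1/2` puts the barrier strictly below `Γ` at time zero.
  set μ : ℝ → ℝ := fun t => e / 2 * Real.exp (-(L * t)) with hμ
  have hμc : Continuous μ := by fun_prop
  have hμ0 : ∀ t, 0 < μ t := fun t => by positivity
  have hμd : ∀ t, HasDerivAt μ (-(L * μ t)) t := fun t => by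
    have h1 : HasDerivAt (fun t => -(L * t)) (-(L * 1)) t := ((hasDerivAt_id t).const_mul L).neg
    refine (h1.exp.const_mul (e / 2)).congr_deriv ?_
    simp only [hμ, mul_one]
    ring
  have hqc : ∀ w, ContinuousOn (fun t => w ⬝ᵥ (P t *ᵥ w)) (Set.Icc 0 T) := fun w =>
    (quadraticCLM w).continuous.comp_continuousOn h.continuousOn
  -- The endpoint `T` is left out, as the derivative is available only inside the interval; it is
  -- recovered by continuity at the end.
  have hstrict : ∀ t ∈ Set.Ico 0 T, ∀ w, w ⬝ᵥ w = 1 → μ t < w ⬝ᵥ (P t *ᵥ w) := by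
    by_contra hcon
    push Not at hcon
    obtain ⟨t₀, ht₀, v₀, hv₀, hle₀⟩ := hcon
    let D : Set (ℝ × (Fin n → ℝ)) := Set.Icc 0 t₀ ×ˢ {v | v ⬝ᵥ v = 1}
    have hDc : IsCompact D := isCompact_Icc.prod (isCompact_dotProduct_self_eq_one n)
    have hf : ContinuousOn (fun p : ℝ × (Fin n → ℝ) => p.2 ⬝ᵥ (P p.1 *ᵥ p.2) - μ p.1) D := by
      have h1 : ContinuousOn (fun p : ℝ × (Fin n → ℝ) => P p.1) D :=
        h.continuousOn.comp continuousOn_fst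
          fun p hp => ⟨hp.1.1, hp.1.2.trans ht₀.2.le⟩
      have h2 : Continuous fun q : Matrix (Fin n) (Fin n) ℝ × (Fin n → ℝ) =>
          q.2 ⬝ᵥ (q.1 *ᵥ q.2) := by fun_prop
      exact (h2.comp_continuousOn (h1.prodMk continuousOn_snd)).sub
        (hμc.comp continuous_fst).continuousOn
    -- The pairs of a time and a unit vector at which the barrier is reached form a compact set, so
    -- there is a first touching time `t₁`.
    have hKc : IsCompact (D ∩ (fun p : ℝ × (Fin n → ℝ) => p.2 ⬝ᵥ (P p.1 *ᵥ p.2) - μ p.1) ⁻¹'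
        Set.Iic 0) :=
      hDc.of_isClosed_subset (hf.preimage_isClosed_of_isClosed hDc.isClosed isClosed_Iic)
        Set.inter_subset_left
    obtain ⟨⟨t₁, v₁⟩, ⟨⟨ht₁, hv₁⟩, hle₁⟩, hmin⟩ := hKc.exists_isMinOn
      ⟨(t₀, v₀), ⟨⟨ht₀.1, le_rfl⟩, hv₀⟩, sub_nonpos.2 hle₀⟩ continuous_fst.continuousOn
    simp only [Set.mem_ofPred_eq, Set.mem_preimage, Set.mem_Iic, sub_nonpos] at hv₁ hle₁ ht₁
    have hbefore : ∀ s, 0 ≤ s → s < t₁ → ∀ w, w ⬝ᵥ w = 1 → μ s < w ⬝ᵥ (P s *ᵥ w) := by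
      intro s hs0 hst w hw
      by_contra hcon
      have := hmin (a := (s, w)) ⟨⟨⟨hs0, hst.le.trans ht₁.2⟩, hw⟩, sub_nonpos.2 (not_lt.1 hcon)⟩
      exact absurd hst (not_lt.2 this)
    have ht₁0 : 0 < t₁ := by
      rcases ht₁.1.lt_or_eq with h0 | h0
      · exact h0
      · exfalso
        have h1 := hΓ v₁
        rw [← h0, h.initial] at hle₁
        simp only [hμ, mul_zero, neg_zero, Real.exp_zero, mul_one] at hle₁
        rw [hv₁] at h1
        linarith
    have ht₁T : t₁ < T := ht₁.2.trans_lt ht₀.2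
    have hnhds : Set.Icc 0 T ∈ nhds t₁ := Icc_mem_nhds ht₁0 ht₁T
    have hev : ∀ᶠ s in nhdsWithin t₁ (Set.Iio t₁), 0 ≤ s ∧ s < t₁ := by
      filter_upwards [self_mem_nhdsWithin, nhdsWithin_le_nhds (Ioi_mem_nhds ht₁0)] with s hs1 hs2
      exact ⟨le_of_lt hs2, hs1⟩
    have hge : ∀ w, w ⬝ᵥ w = 1 → μ t₁ ≤ w ⬝ᵥ (P t₁ *ᵥ w) := fun w hw =>
      le_of_tendsto_of_tendsto (hμc.continuousAt.tendsto.mono_left nhdsWithin_le_nhds)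
        (((hqc w).continuousAt hnhds).tendsto.mono_left nhdsWithin_le_nhds)
        (hev.mono fun s hs => (hbefore s hs.1 hs.2 w hw).le)
    have heq : v₁ ⬝ᵥ (P t₁ *ᵥ v₁) = μ t₁ := le_antisymm hle₁ (hge v₁ hv₁)
    have hsym := hs t₁ ⟨ht₁0.le, ht₁T.le⟩
    -- At first touching `P t₁ - μ t₁` is positive semidefinite with a null vector `v₁` of its form,
    -- so `v₁` is an eigenvector of `P t₁` for the eigenvalue `μ t₁`.
    have hpsd : (P t₁ - μ t₁ • (1 : Matrix (Fin n) (Fin n) ℝ)).PosSemidef := by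
      refine PosSemidef.of_dotProduct_mulVec_nonneg ?_ fun w => ?_
      · rw [IsHermitian, conjTranspose_eq_transpose_of_trivial, transpose_sub, hsym,
          transpose_smul, transpose_one]
      · have := quadratic_ge_of_unit hge w
        simp only [star_trivial, sub_mulVec, smul_mulVec, one_mulVec, dotProduct_sub,
          dotProduct_smul, smul_eq_mul]
        linarith
    have hker : P t₁ *ᵥ v₁ = μ t₁ • v₁ := by
      have h1 := (hpsd.dotProduct_mulVec_zero_iff v₁).1 (by
        simp only [star_trivial, sub_mulVec, smul_mulVec, one_mulVec, dotProduct_sub,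
          dotProduct_smul, smul_eq_mul, heq, hv₁]
        ring)
      rw [sub_mulVec, smul_mulVec, one_mulVec] at h1
      exact sub_eq_zero.1 h1
    have hder : HasDerivAt (fun t => v₁ ⬝ᵥ (P t *ᵥ v₁) - μ t)
        (v₁ ⬝ᵥ (riccatiField B C S (P t₁) *ᵥ v₁) - -(L * μ t₁)) t₁ :=
      ((quadraticCLM v₁).hasFDerivAt.comp_hasDerivAt t₁
        (h.hasDerivAt t₁ ⟨ht₁0, ht₁T⟩)).sub (hμd t₁)
    have hpos : 0 < v₁ ⬝ᵥ (riccatiField B C S (P t₁) *ᵥ v₁) - -(L * μ t₁) := by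
      rw [dotProduct_riccatiField hsym, hker]
      simp only [mulVec_smul, dotProduct_smul, smul_dotProduct, smul_eq_mul]
      have h1 := abs_le.1 (abs_dotProduct_mulVec_le S.A v₁)
      have h2 := (abs_le.1 (abs_dotProduct_mulVec_le S.Q⁻¹ (C *ᵥ v₁))).2
      have h3 := dotProduct_mulVec_self_le C v₁
      have h4 := hR.dotProduct_mulVec_nonneg (Bᵀ *ᵥ v₁)
      rw [star_trivial] at h4
      rw [hv₁, mul_one] at h1 h3
      have h5 : (C *ᵥ v₁) ⬝ᵥ (S.Q⁻¹ *ᵥ (C *ᵥ v₁)) ≤ M * ‖C‖ ^ 2 :=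
        h2.trans (mul_le_mul hQ h3 (dotProduct_self_nonneg_real _) hM)
      have hμ1 : μ t₁ ≤ 1 := by
        have : Real.exp (-(L * t₁)) ≤ 1 := Real.exp_le_one_iff.2 (by
          have := mul_nonneg hL0 ht₁0.le
          linarith)
        have := mul_le_mul (by linarith : e / 2 ≤ 1) this (Real.exp_pos _).le zero_le_one
        simpa [hμ] using this
      have hm := hμ0 t₁
      set ν := μ t₁
      -- Here `ν ≤ 1` turns the quadratic term into one linear in `ν`, which `L ν` can absorb.
      have h6 : ν * (ν * ((C *ᵥ v₁) ⬝ᵥ (S.Q⁻¹ *ᵥ (C *ᵥ v₁)))) ≤ ν * (1 * (M * ‖C‖ ^ 2)) := by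
        calc _ ≤ ν * (ν * (M * ‖C‖ ^ 2)) := by gcongr
          _ ≤ _ := by gcongr
      have h7 : ν * (-M) ≤ ν * (v₁ ⬝ᵥ (S.A *ᵥ v₁)) :=
        mul_le_mul_of_nonneg_left (by linarith [h1.1]) hm.le
      rw [hL]
      linarith
    -- The gap vanishes at `t₁` and is positive before, so its slopes from the left are negative,
    -- against the positive derivative.
    have hslope := (hasDerivAt_iff_tendsto_slope.1 hder).mono_left
      (nhdsWithin_mono t₁ (fun s (hs : s < t₁) => ne_of_lt hs) :
        nhdsWithin t₁ (Set.Iio t₁) ≤ nhdsWithin t₁ {t₁}ᶜ)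
    obtain ⟨s, hs1, hs2⟩ := ((hslope.eventually (lt_mem_nhds hpos)).and hev).exists
    rw [slope_def_field, heq, sub_self, sub_zero] at hs1
    have h8 := hbefore s hs2.1 hs2.2 v₁ hv₁
    have h9 := div_neg_of_pos_of_neg (sub_pos.2 h8) (sub_neg.2 hs2.2)
    linarith
  intro t ht v
  refine quadratic_ge_of_unit (fun w hw => ?_) v
  have hcl : t ∈ closure (Set.Ico 0 T) := by
    rw [closure_Ico hT.ne]
    exact ht
  have hcw : ContinuousOn (fun t => w ⬝ᵥ (P t *ᵥ w)) (closure (Set.Ico 0 T)) := by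
    rw [closure_Ico hT.ne]
    exact hqc w
  exact le_on_closure (fun s hs => (hstrict s hs w hw).le) hμc.continuousOn hcw hcl

/-- A nonnegative error covariance is bounded in terms of the data alone. -/
theorem IsErrorCovariance.norm_le {S : FilterData n m r} {M : ℝ} (hT : 0 ≤ T) (hM : 0 < M)
    (hS : S.BoundedBy M) (hQ : S.Q.PosDef) {P : ℝ → Matrix (Fin n) (Fin n) ℝ}
    (h : IsErrorCovariance T B C S P) (hs : ∀ t ∈ Set.Icc 0 T, (P t)ᵀ = P t)
    (hP : ∀ t ∈ Set.Icc 0 T, ∀ v, 0 ≤ v ⬝ᵥ (P t *ᵥ v)) :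
    ∀ t ∈ Set.Icc 0 T, ‖P t‖ ≤ (M + T * (M * ‖B‖ ^ 2)) * Real.exp (2 * M * T) := by
  intro t ht
  have key := le_mul_exp_of_le_integral (T := T) (a := M) (K := 2 * M) (by positivity)
    (u := fun s => ‖P s‖) (h := fun _ => M * ‖B‖ ^ 2) h.continuousOn.norm
    intervalIntegrable_const (fun _ _ => by positivity) (by
      intro s hs0
      have hci : ContinuousOn (fun τ => 2 * M * ‖P τ‖ + M * ‖B‖ ^ 2) (Set.Icc 0 s) :=
        (continuousOn_const.mul (h.continuousOn.mono (Set.Icc_subset_Icc_right hs0.2)).norm).add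
          continuousOn_const
      have hii : IntervalIntegrable (fun τ => 2 * M * ‖P τ‖ + M * ‖B‖ ^ 2) volume 0 s := by
        apply ContinuousOn.intervalIntegrable
        rwa [Set.uIcc_of_le hs0.1]
      have hnn : 0 ≤ ∫ τ in (0 : ℝ)..s, (2 * M * ‖P τ‖ + M * ‖B‖ ^ 2) :=
        intervalIntegral.integral_nonneg hs0.1 fun τ _ => by positivity
      refine norm_le_of_quadratic_le (hs s hs0) (by positivity) (hP s hs0) fun v => ?_
      obtain ⟨i1, e1⟩ := h.integral_eq s hs0
      have e2 := congrArg (quadraticCLM v) e1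
      rw [← (quadraticCLM v).intervalIntegral_comp_comm i1, map_sub] at e2
      have h1 := (abs_le.1 (abs_dotProduct_mulVec_le S.Γ v)).2.trans
        (mul_le_mul_of_nonneg_right hS.Γ_le (dotProduct_self_nonneg_real v))
      have h2 : ∫ τ in (0 : ℝ)..s, quadraticCLM v (riccatiField B C S (P τ)) ≤
          ∫ τ in (0 : ℝ)..s, (2 * M * ‖P τ‖ + M * ‖B‖ ^ 2) * (v ⬝ᵥ v) := by
        refine intervalIntegral.integral_mono_on hs0.1 ?_ (hii.mul_const _) fun τ hτ => ?_
        · exact ⟨(quadraticCLM v).integrable_comp i1.1, (quadraticCLM v).integrable_comp i1.2⟩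
        · have hτ' : τ ∈ Set.Icc 0 T := ⟨hτ.1, hτ.2.trans hs0.2⟩
          rw [quadraticCLM_apply, dotProduct_riccatiField (hs τ hτ')]
          have h3 := (abs_le.1 (abs_dotProduct_mulVec_le (S.A * P τ) v)).2
          rw [← mulVec_mulVec] at h3
          -- The quadratic Riccati term has a favourable sign and is dropped, which leaves growth
          -- linear in `‖P τ‖`.
          have h4 := hQ.inv.posSemidef.dotProduct_mulVec_nonneg (C *ᵥ (P τ *ᵥ v))
          rw [star_trivial] at h4
          have h5 := (abs_le.1 (abs_dotProduct_mulVec_le S.R (Bᵀ *ᵥ v))).2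
          have h6 := dotProduct_mulVec_self_le Bᵀ v
          rw [norm_transpose_eq] at h6
          have h7 := mul_le_mul hS.R_le h6 (dotProduct_self_nonneg_real _) hM.le
          have h8 : ‖S.A * P τ‖ ≤ M * ‖P τ‖ := (l2_opNorm_mul _ _).trans
            (mul_le_mul_of_nonneg_right hS.A_le (norm_nonneg _))
          have h9 := mul_le_mul_of_nonneg_right h8 (dotProduct_self_nonneg_real v)
          linarith
      rw [intervalIntegral.integral_mul_const] at h2
      rw [e2] at h2
      simp only [quadraticCLM_apply] at h2
      linarith) t ht
  simp only [intervalIntegral.integral_const, smul_eq_mul, sub_zero] at key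
  refine key.trans ?_
  have := ht.2
  gcongr

end Bounds

/-! ### Bounds and Lipschitz dependence for the filter trajectories. -/

section Trajectory

variable {n m r : ℕ} {T : ℝ} {C : Matrix (Fin r) (Fin n) ℝ} {x₀ : Fin n → ℝ} {y : ℝ → Fin r → ℝ}

theorem ContinuousOn.intervalIntegrable_mulVec {k l : ℕ} {t : ℝ}
    {G : ℝ → Matrix (Fin k) (Fin l) ℝ} {z : ℝ → Fin l → ℝ} (hG : ContinuousOn G (Set.uIcc 0 t))
    (hz : IntervalIntegrable z volume 0 t) :
    IntervalIntegrable (fun s => G s *ᵥ z s) volume 0 t := by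
  have hcomp : ∀ i, IntervalIntegrable (fun s => (G s *ᵥ z s) i) volume 0 t := fun i => by
    have hz' : ∀ j, IntervalIntegrable (fun s => z s j) volume 0 t := fun j =>
      ⟨(ContinuousLinearMap.proj (R := ℝ) (φ := fun _ : Fin l => ℝ) j).integrable_comp hz.1,
        (ContinuousLinearMap.proj (R := ℝ) (φ := fun _ : Fin l => ℝ) j).integrable_comp hz.2⟩
    have hG' : ∀ j, ContinuousOn (fun s => G s i j) (Set.uIcc 0 t) := fun j =>
      (continuous_id.matrix_elem i j).comp_continuousOn hG
    have := IntervalIntegrable.sum Finset.univ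
      (f := fun (j : Fin l) (s : ℝ) => G s i j * z s j) fun j _ => (hz' j).continuousOn_mul (hG' j)
    refine this.congr ?_
    exact fun s _ => by simp [mulVec, dotProduct]
  exact ⟨Integrable.of_eval fun i => (hcomp i).1, Integrable.of_eval fun i => (hcomp i).2⟩

theorem IsKalmanTrajectory.intervalIntegrable {S : FilterData n m r}
    {P : ℝ → Matrix (Fin n) (Fin n) ℝ} {x : ℝ → Fin n → ℝ}
    (hy : IntervalIntegrable y volume 0 T) (hP : ContinuousOn P (Set.Icc 0 T))
    (h : IsKalmanTrajectory T C x₀ y S P x) :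
    ∀ t ∈ Set.Icc 0 T, IntervalIntegrable
      (fun s => S.A *ᵥ x s + (P s * Cᵀ * S.Q⁻¹) *ᵥ (y s - C *ᵥ x s)) volume 0 t := by
  intro t ht
  have hT : 0 ≤ T := ht.1.trans ht.2
  have hsub : Set.uIcc 0 t ⊆ Set.Icc 0 T := by
    rw [Set.uIcc_of_le ht.1]
    exact Set.Icc_subset_Icc_right ht.2
  have hx := h.continuousOn.mono hsub
  have h1 : ContinuousOn (fun s => S.A *ᵥ x s) (Set.uIcc 0 t) :=
    (by fun_prop : Continuous fun w : Fin n → ℝ => S.A *ᵥ w).comp_continuousOn hx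
  have h2 : ContinuousOn (fun s => C *ᵥ x s) (Set.uIcc 0 t) :=
    (by fun_prop : Continuous fun w : Fin n → ℝ => C *ᵥ w).comp_continuousOn hx
  have h3 : ContinuousOn (fun s => P s * Cᵀ * S.Q⁻¹) (Set.uIcc 0 t) :=
    (by fun_prop : Continuous fun X : Matrix (Fin n) (Fin n) ℝ => X * Cᵀ * S.Q⁻¹).comp_continuousOn
      (hP.mono hsub)
  refine h1.intervalIntegrable.add (h3.intervalIntegrable_mulVec (IntervalIntegrable.sub ?_
    h2.intervalIntegrable))
  exact hy.mono_set (by rwa [Set.uIcc_of_le hT])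

/-- Grönwall's inequality for the integrated equation. Vectors carry the sup norm and matrices the
spectral norm, whence the factors `√n` and `√r`. -/
theorem IsKalmanTrajectory.norm_le {S : FilterData n m r} {P : ℝ → Matrix (Fin n) (Fin n) ℝ}
    {x : ℝ → Fin n → ℝ} {M k : ℝ} (hM : 0 ≤ M) (hk : 0 ≤ k)
    (hy : IntervalIntegrable y volume 0 T) (hA : ‖S.A‖ ≤ M)
    (hgain : ∀ t ∈ Set.Icc 0 T, ‖P t * Cᵀ * S.Q⁻¹‖ ≤ k)
    (h : IsKalmanTrajectory T C x₀ y S P x) :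
    ∀ t ∈ Set.Icc 0 T, ‖x t‖ ≤ (‖x₀‖ + ∫ s in (0 : ℝ)..T, √r * k * ‖y s‖) *
      Real.exp ((√n * M + √r * k * (√n * ‖C‖)) * T) := by
  intro t ht
  have hT : 0 ≤ T := ht.1.trans ht.2
  set L := √n * M + √r * k * (√n * ‖C‖) with hL
  have hL0 : 0 ≤ L := by positivity
  have hyn : IntervalIntegrable (fun s => √r * k * ‖y s‖) volume 0 T := hy.norm.const_mul _
  have key := le_mul_exp_of_le_integral (T := T) (a := ‖x₀‖) hL0 (u := fun s => ‖x s‖)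
    (h := fun s => √r * k * ‖y s‖) h.continuousOn.norm hyn (fun _ _ => by positivity) (by
      intro s hs
      have hsub : Set.uIcc 0 s ⊆ Set.uIcc 0 T := by
        rw [Set.uIcc_of_le hs.1, Set.uIcc_of_le hT]
        exact Set.Icc_subset_Icc_right hs.2
      have hx : ContinuousOn x (Set.uIcc 0 s) :=
        h.continuousOn.mono (by rwa [Set.uIcc_of_le hT] at hsub)
      rw [h.integral_eq s hs]
      refine norm_add_le_of_le le_rfl ?_
      refine intervalIntegral.norm_integral_le_of_norm_le hs.1 (ae_of_all _ fun τ hτ => ?_)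
        ((hx.norm.intervalIntegrable.const_mul L).add (hyn.mono_set hsub))
      have hg := hgain τ ⟨hτ.1.le, hτ.2.trans hs.2⟩
      have h1 : ‖S.A *ᵥ x τ‖ ≤ √n * M * ‖x τ‖ := (norm_mulVec_le_sqrt _ _).trans (by gcongr)
      have h2 : ‖y τ - C *ᵥ x τ‖ ≤ ‖y τ‖ + √n * ‖C‖ * ‖x τ‖ :=
        norm_sub_le_of_le le_rfl (norm_mulVec_le_sqrt _ _)
      have h3 : ‖(P τ * Cᵀ * S.Q⁻¹) *ᵥ (y τ - C *ᵥ x τ)‖ ≤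
          √r * k * (‖y τ‖ + √n * ‖C‖ * ‖x τ‖) :=
        (norm_mulVec_le_sqrt _ _).trans (by gcongr)
      refine (norm_add_le_of_le h1 h3).trans (le_of_eq ?_)
      rw [hL]
      ring) t ht
  refine key.trans ?_
  have h0 : 0 ≤ ∫ s in (0 : ℝ)..T, √r * k * ‖y s‖ :=
    intervalIntegral.integral_nonneg hT fun _ _ => by positivity
  have := ht.2
  gcongr

/-- Kalman trajectories depend Lipschitz continuously on the system matrix and the gain. -/
theorem IsKalmanTrajectory.norm_sub_le {S S' : FilterData n m r}
    {P P' : ℝ → Matrix (Fin n) (Fin n) ℝ} {x x' : ℝ → Fin n → ℝ} {M k X g δ : ℝ}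
    (hM : 0 ≤ M) (hk : 0 ≤ k) (hX : 0 ≤ X) (hg0 : 0 ≤ g) (hδ : 0 ≤ δ)
    (hy : IntervalIntegrable y volume 0 T)
    (hP : ContinuousOn P (Set.Icc 0 T)) (hP' : ContinuousOn P' (Set.Icc 0 T))
    (hA' : ‖S'.A‖ ≤ M) (hA : ‖S.A - S'.A‖ ≤ δ)
    (hgain' : ∀ t ∈ Set.Icc 0 T, ‖P' t * Cᵀ * S'.Q⁻¹‖ ≤ k)
    (hgain : ∀ t ∈ Set.Icc 0 T, ‖P t * Cᵀ * S.Q⁻¹ - P' t * Cᵀ * S'.Q⁻¹‖ ≤ g * δ)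
    (hx : ∀ t ∈ Set.Icc 0 T, ‖x t‖ ≤ X)
    (h : IsKalmanTrajectory T C x₀ y S P x) (h' : IsKalmanTrajectory T C x₀ y S' P' x') :
    ∀ t ∈ Set.Icc 0 T, ‖x t - x' t‖ ≤
      ((∫ s in (0 : ℝ)..T, (√n * X + √r * g * (‖y s‖ + √n * ‖C‖ * X))) *
      Real.exp ((√n * M + √r * k * (√n * ‖C‖)) * T)) * δ := by
  intro t ht
  have hT : 0 ≤ T := ht.1.trans ht.2
  set L := √n * M + √r * k * (√n * ‖C‖) with hL
  have hL0 : 0 ≤ L := by positivity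
  have hyn : IntervalIntegrable (fun s => δ * (√n * X + √r * g * (‖y s‖ + √n * ‖C‖ * X)))
      volume 0 T :=
    (intervalIntegrable_const.add
      ((hy.norm.add intervalIntegrable_const).const_mul _)).const_mul _
  have hc : ContinuousOn (fun s => ‖x s - x' s‖) (Set.Icc 0 T) :=
    (h.continuousOn.sub h'.continuousOn).norm
  have key := le_mul_exp_of_le_integral (T := T) (a := 0) hL0 (u := fun s => ‖x s - x' s‖)
    (h := fun s => δ * (√n * X + √r * g * (‖y s‖ + √n * ‖C‖ * X))) hc hyn
    (fun _ _ => by positivity) (by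
      intro s hs
      have hsub : Set.uIcc 0 s ⊆ Set.uIcc 0 T := by
        rw [Set.uIcc_of_le hs.1, Set.uIcc_of_le hT]
        exact Set.Icc_subset_Icc_right hs.2
      have hc' : ContinuousOn (fun s => ‖x s - x' s‖) (Set.uIcc 0 s) :=
        hc.mono (by rwa [Set.uIcc_of_le hT] at hsub)
      rw [h.integral_eq s hs, h'.integral_eq s hs, add_sub_add_left_eq_sub,
        ← intervalIntegral.integral_sub (h.intervalIntegrable hy hP s hs)
          (h'.intervalIntegrable hy hP' s hs), zero_add]
      refine intervalIntegral.norm_integral_le_of_norm_le hs.1 (ae_of_all _ fun τ hτ => ?_)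
        ((hc'.intervalIntegrable.const_mul L).add (hyn.mono_set hsub))
      have hτ' : τ ∈ Set.Icc 0 T := ⟨hτ.1.le, hτ.2.trans hs.2⟩
      have hg1 := hgain τ hτ'
      have hg2 := hgain' τ hτ'
      have hxτ := hx τ hτ'
      have h1 : ‖(S.A - S'.A) *ᵥ x τ‖ ≤ √n * δ * X := (norm_mulVec_le_sqrt _ _).trans (by gcongr)
      have h2 : ‖S'.A *ᵥ (x τ - x' τ)‖ ≤ √n * M * ‖x τ - x' τ‖ :=
        (norm_mulVec_le_sqrt _ _).trans (by gcongr)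
      have h3 : ‖y τ - C *ᵥ x τ‖ ≤ ‖y τ‖ + √n * ‖C‖ * X :=
        norm_sub_le_of_le le_rfl ((norm_mulVec_le_sqrt _ _).trans (by gcongr))
      have h4 : ‖(P τ * Cᵀ * S.Q⁻¹ - P' τ * Cᵀ * S'.Q⁻¹) *ᵥ (y τ - C *ᵥ x τ)‖ ≤
          √r * (g * δ) * (‖y τ‖ + √n * ‖C‖ * X) :=
        (norm_mulVec_le_sqrt _ _).trans (by gcongr)
      have h5 : ‖(P' τ * Cᵀ * S'.Q⁻¹) *ᵥ (C *ᵥ (x τ - x' τ))‖ ≤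
          √r * k * (√n * ‖C‖ * ‖x τ - x' τ‖) :=
        (norm_mulVec_le_sqrt _ _).trans (by
          have := norm_mulVec_le_sqrt C (x τ - x' τ)
          gcongr)
      -- The split pairs data differences with `x`, which is bounded by `X`, and lets only the
      -- primed coefficients act on `x - x'`.
      have e : (S.A *ᵥ x τ + (P τ * Cᵀ * S.Q⁻¹) *ᵥ (y τ - C *ᵥ x τ)) -
          (S'.A *ᵥ x' τ + (P' τ * Cᵀ * S'.Q⁻¹) *ᵥ (y τ - C *ᵥ x' τ)) =
          (S.A - S'.A) *ᵥ x τ + S'.A *ᵥ (x τ - x' τ) +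
          (P τ * Cᵀ * S.Q⁻¹ - P' τ * Cᵀ * S'.Q⁻¹) *ᵥ (y τ - C *ᵥ x τ) -
          (P' τ * Cᵀ * S'.Q⁻¹) *ᵥ (C *ᵥ (x τ - x' τ)) := by
        simp only [sub_mulVec, mulVec_sub]
        abel
      rw [e]
      refine (norm_sub_le_of_le (norm_add_le_of_le (norm_add_le_of_le h1 h2) h4) h5).trans
        (le_of_eq ?_)
      rw [hL]
      ring) t ht
  rw [intervalIntegral.integral_const_mul, zero_add] at key
  refine key.trans ?_
  have h0 : 0 ≤ ∫ s in (0 : ℝ)..T, (√n * X + √r * g * (‖y s‖ + √n * ‖C‖ * X)) :=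
    intervalIntegral.integral_nonneg hT fun _ _ => by positivity
  set I := ∫ s in (0 : ℝ)..T, (√n * X + √r * g * (‖y s‖ + √n * ‖C‖ * X))
  have h1 : Real.exp (L * t) ≤ Real.exp (L * T) :=
    Real.exp_le_exp.2 (mul_le_mul_of_nonneg_left ht.2 hL0)
  calc δ * I * Real.exp (L * t) ≤ δ * I * Real.exp (L * T) := by gcongr
    _ = _ := by ring

theorem norm_gain_sub_le {S S' : FilterData n m r} {M K c : ℝ} (hM : 0 ≤ M) (hK : 0 ≤ K)
    (hc : 0 ≤ c) (hS : S.BoundedBy M) (hS' : S'.BoundedBy M) (hQ : IsUnit S.Q) (hQ' : IsUnit S'.Q)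
    {P P' : Matrix (Fin n) (Fin n) ℝ} (hP' : ‖P'‖ ≤ K) (h : ‖P - P'‖ ≤ c * (S - S').norm1) :
    ‖P * Cᵀ * S.Q⁻¹ - P' * Cᵀ * S'.Q⁻¹‖ ≤
      (c * ‖C‖ * M + K * ‖C‖ * M ^ 2) * (S - S').norm1 := by
  have e : P * Cᵀ * S.Q⁻¹ - P' * Cᵀ * S'.Q⁻¹ =
      (P - P') * Cᵀ * S.Q⁻¹ + P' * Cᵀ * (S.Q⁻¹ - S'.Q⁻¹) := by
    simp only [Matrix.sub_mul, Matrix.mul_sub]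
    abel
  have hδ := FilterData.norm1_nonneg (S - S')
  have hq := hS.Qinv_le
  have hI := FilterData.norm_inv_sub_inv_le hM hS hS' hQ hQ'
  have h1 : ‖(P - P') * Cᵀ * S.Q⁻¹‖ ≤ (c * (S - S').norm1) * ‖C‖ * M :=
    (norm_mul_mul_le _ _ _).trans (by rw [norm_transpose_eq]; gcongr)
  have h2 : ‖P' * Cᵀ * (S.Q⁻¹ - S'.Q⁻¹)‖ ≤ K * ‖C‖ * (M ^ 2 * (S - S').norm1) :=
    (norm_mul_mul_le _ _ _).trans (by rw [norm_transpose_eq]; gcongr)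
  rw [e]
  exact (norm_add_le_of_le h1 h2).trans (le_of_eq (by ring))

end Trajectory

/-! ### Expectations over the parameter set. -/

section Model

variable {n m r : ℕ} (U : UncertainModel n m r)

namespace UncertainModel

variable {U}

theorem N_pos {σ : U.Param} (hσ : σ ∈ U.Sigma) : (0 : ℝ) < U.N :=
  Nat.cast_pos.2 (Finset.card_pos.2 ⟨σ, hσ⟩)

theorem expectation_posDef {k : ℕ} {σ : U.Param} (hσ : σ ∈ U.Sigma)
    {X : U.Param → Matrix (Fin k) (Fin k) ℝ} (hX : ∀ σ ∈ U.Sigma, (X σ).PosDef) :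
    (U.expectation X).PosDef :=
  (posDef_sum ⟨σ, hσ⟩ hX).smul (inv_pos.2 (N_pos hσ))

/-- The constant `X σ` is its own expectation because `N > 0`, so this is the triangle inequality
for the mean of `X τ - X σ`. -/
theorem norm_expectation_sub_le {E : Type*} [NormedAddCommGroup E] [NormedSpace ℝ E]
    {σ : U.Param} (hσ : σ ∈ U.Sigma) (X : U.Param → E) :
    ‖U.expectation X - X σ‖ ≤ U.expectation fun τ => ‖X τ - X σ‖ := by
  have hN := N_pos hσ
  have e : U.expectation X - X σ = (U.N : ℝ)⁻¹ • ∑ τ ∈ U.Sigma, (X τ - X σ) := by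
    rw [Finset.sum_sub_distrib, Finset.sum_const, smul_sub, ← Nat.cast_smul_eq_nsmul ℝ, smul_smul]
    change _ = _ - ((U.N : ℝ)⁻¹ * (U.N : ℝ)) • X σ
    rw [inv_mul_cancel₀ hN.ne', one_smul]
    rfl
  rw [e, norm_smul, Real.norm_of_nonneg (inv_nonneg.2 hN.le)]
  exact mul_le_mul_of_nonneg_left (norm_sum_le _ _) (inv_nonneg.2 hN.le)

theorem norm1_meanData_sub_le {σ : U.Param} (hσ : σ ∈ U.Sigma) :
    (U.meanData - U.data σ).norm1 ≤ U.expectation fun τ => (U.data τ - U.data σ).norm1 := by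
  have e : (U.expectation fun τ => (U.data τ - U.data σ).norm1) =
      (U.expectation fun τ => ‖(U.data τ).A - (U.data σ).A‖) +
      (U.expectation fun τ => ‖(U.data τ).Γ - (U.data σ).Γ‖) +
      (U.expectation fun τ => ‖(U.data τ).R - (U.data σ).R‖) +
      (U.expectation fun τ => ‖(U.data τ).Q - (U.data σ).Q‖) := by
    simp only [expectation, ← smul_add, ← Finset.sum_add_distrib]
    rfl
  rw [e]
  exact add_le_add (add_le_add (add_le_add
    (norm_expectation_sub_le hσ fun τ => (U.data τ).A)
    (norm_expectation_sub_le hσ fun τ => (U.data τ).Γ))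
    (norm_expectation_sub_le hσ fun τ => (U.data τ).R))
    (norm_expectation_sub_le hσ fun τ => (U.data τ).Q)

theorem data_posDef {σ : U.Param} (hσ : σ ∈ U.Sigma) :
    (U.data σ).Γ.PosDef ∧ (U.data σ).R.PosDef ∧ (U.data σ).Q.PosDef := by
  simp only [Sigma, Finset.mem_product] at hσ
  exact ⟨U.γ_posDef _ hσ.2.1, U.ρ_posDef _ hσ.2.2.1, U.q_posDef _ hσ.2.2.2⟩

theorem meanData_posDef {σ : U.Param} (hσ : σ ∈ U.Sigma) :
    U.meanData.Γ.PosDef ∧ U.meanData.R.PosDef ∧ U.meanData.Q.PosDef :=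
  ⟨expectation_posDef hσ fun _ hτ => (data_posDef hτ).1,
    expectation_posDef hσ fun _ hτ => (data_posDef hτ).2.1,
    expectation_posDef hσ fun _ hτ => (data_posDef hτ).2.2⟩

end UncertainModel

end Model

/-! ### Uniform Lipschitz estimate in the weighted norm, and conclusion. -/

theorem FilterData.BoundedBy.mono {n m r : ℕ} {S : FilterData n m r} {M M' : ℝ}
    (h : S.BoundedBy M) (hM : M ≤ M') : S.BoundedBy M' :=
  ⟨h.A_le.trans hM, h.Γ_le.trans hM, h.R_le.trans hM, h.Q_le.trans hM, h.Qinv_le.trans hM⟩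

theorem Matrix.PosDef.transpose_eq {k : ℕ} {X : Matrix (Fin k) (Fin k) ℝ} (hX : X.PosDef) :
    Xᵀ = X := by
  rw [← conjTranspose_eq_transpose_of_trivial]
  exact hX.isHermitian

/-- The barrier started from `e = M⁻¹`, which bounds `Γ` from below, and evaluated at its smallest
value, at time `T`. -/
theorem IsErrorCovariance.symm_and_quadratic_ge {n m r : ℕ} {T M : ℝ}
    {B : Matrix (Fin n) (Fin m) ℝ} {C : Matrix (Fin r) (Fin n) ℝ}
    {S : FilterData n m r} (hT : 0 < T) (hM : 1 ≤ M)
    (hS : S.Γ.PosDef ∧ S.R.PosDef ∧ S.Q.PosDef) (hA : ‖S.A‖ ≤ M) (hQ : ‖S.Q⁻¹‖ ≤ M)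
    (hΓ : ‖S.Γ⁻¹‖ ≤ M) {P : ℝ → Matrix (Fin n) (Fin n) ℝ} (h : IsErrorCovariance T B C S P) :
    ∀ t ∈ Set.Icc 0 T, (P t)ᵀ = P t ∧ ∀ v,
      M⁻¹ / 2 * Real.exp (-((2 * M + M * ‖C‖ ^ 2 + 1) * T)) * (v ⬝ᵥ v) ≤ v ⬝ᵥ (P t *ᵥ v) := by
  have hM0 : 0 < M := zero_lt_one.trans_le hM
  have hs := h.transpose_eq hT.le hS.1.transpose_eq hS.2.1.transpose_eq hS.2.2.transpose_eq
    hS.2.2.isUnit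
  intro t ht
  refine ⟨hs t ht, fun v => le_trans ?_ (h.quadratic_ge hT hA hQ hS.2.1.posSemidef
    (inv_pos.2 hM0) (inv_le_one_of_one_le₀ hM) (quadratic_ge_of_norm_inv_le hS.1 hM0 hΓ)
    hs t ht v)⟩
  have := ht.2
  have := dotProduct_self_nonneg_real v
  gcongr

theorem weightedNorm_inv_le {k : ℕ} {P : Matrix (Fin k) (Fin k) ℝ} (hs : Pᵀ = P) {e : ℝ}
    (he : 0 < e) (h : ∀ v, e * (v ⬝ᵥ v) ≤ v ⬝ᵥ (P *ᵥ v)) (v : Fin k → ℝ) :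
    weightedNorm P⁻¹ v ≤ √e⁻¹ * √k * ‖v‖ := by
  have hP : P.PosDef := by
    refine PosDef.of_dotProduct_mulVec_pos ?_ fun w hw => ?_
    · rwa [IsHermitian, conjTranspose_eq_transpose_of_trivial]
    · have h1 : 0 < w ⬝ᵥ w := lt_of_le_of_ne (dotProduct_self_nonneg_real w)
        fun h => hw (dotProduct_self_eq_zero.1 h.symm)
      exact (mul_pos he h1).trans_le (h w)
  calc weightedNorm P⁻¹ v ≤ √(e⁻¹ * (v ⬝ᵥ v)) := Real.sqrt_le_sqrt (inv_quadratic_le hP he h v)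
    _ = √e⁻¹ * ‖WithLp.toLp 2 v‖ := by
        rw [← norm_toLp_sq, Real.sqrt_mul (inv_nonneg.2 he.le), Real.sqrt_sq (norm_nonneg _)]
    _ ≤ _ := by
        rw [mul_assoc]
        exact mul_le_mul_of_nonneg_left (norm_toLp_le_sqrt_mul v) (Real.sqrt_nonneg _)

/-- The Kalman filters of two sets of data differ at most by a multiple, uniform for bounded data,
of the distance of the data. -/
theorem exists_weightedNorm_sub_le {n m r : ℕ} (T : ℝ) (hT : 0 < T)
    (B : Matrix (Fin n) (Fin m) ℝ) (C : Matrix (Fin r) (Fin n) ℝ)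
    (x₀ : Fin n → ℝ) (y : ℝ → Fin r → ℝ)
    (hy : IntervalIntegrable y volume 0 T) {M : ℝ} (hM1 : 1 ≤ M) :
    ∃ c : ℝ, 0 < c ∧ ∀ S S' : FilterData n m r,
      S.Γ.PosDef ∧ S.R.PosDef ∧ S.Q.PosDef → S'.Γ.PosDef ∧ S'.R.PosDef ∧ S'.Q.PosDef →
      S.BoundedBy M → S'.BoundedBy M → ‖S'.Γ⁻¹‖ ≤ M →
      ∀ (P P' : ℝ → Matrix (Fin n) (Fin n) ℝ) (x x' : ℝ → Fin n → ℝ),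
        IsErrorCovariance T B C S P → IsKalmanTrajectory T C x₀ y S P x →
        IsErrorCovariance T B C S' P' → IsKalmanTrajectory T C x₀ y S' P' x' →
        ∀ t ∈ Set.Icc 0 T, weightedNorm (P' t)⁻¹ (x t - x' t) ≤ c * (S - S').norm1 := by
  have hM0 : 0 < M := zero_lt_one.trans_le hM1
  set e := M⁻¹ / 2 * Real.exp (-((2 * M + M * ‖C‖ ^ 2 + 1) * T)) with he
  have he0 : 0 < e := by positivity
  set K := (M + T * (M * ‖B‖ ^ 2)) * Real.exp (2 * M * T) with hK
  have hK0 : 0 ≤ K := by positivity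
  set k := K * ‖C‖ * M with hk
  have hk0 : 0 ≤ k := by positivity
  set c := (1 + T * (2 * K + K ^ 2 * ‖C‖ ^ 2 * M ^ 2 + ‖B‖ ^ 2)) *
    Real.exp ((2 * M + 2 * (K * (‖C‖ * M * ‖C‖))) * T) with hc
  have hc0 : 0 ≤ c := by positivity
  set g := c * ‖C‖ * M + K * ‖C‖ * M ^ 2 with hg
  have hg0 : 0 ≤ g := by positivity
  set X := (‖x₀‖ + ∫ s in (0 : ℝ)..T, √r * k * ‖y s‖) *
    Real.exp ((√n * M + √r * k * (√n * ‖C‖)) * T) with hX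
  have hX0 : 0 ≤ X := by
    have : 0 ≤ ∫ s in (0 : ℝ)..T, √r * k * ‖y s‖ :=
      intervalIntegral.integral_nonneg hT.le fun _ _ => by positivity
    positivity
  set b := (∫ s in (0 : ℝ)..T, (√n * X + √r * g * (‖y s‖ + √n * ‖C‖ * X))) *
    Real.exp ((√n * M + √r * k * (√n * ‖C‖)) * T) with hb
  have hb0 : 0 ≤ b := by
    have : 0 ≤ ∫ s in (0 : ℝ)..T, (√n * X + √r * g * (‖y s‖ + √n * ‖C‖ * X)) :=
      intervalIntegral.integral_nonneg hT.le fun _ _ => by positivity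
    positivity
  -- The summand `1` only ensures that the constant is positive.
  refine ⟨√e⁻¹ * √n * b + 1, by positivity, ?_⟩
  intro S S' hSpd hSpd' hS hS' hΓ' P P' x x' hP hx hP' hx' t ht
  have hlow' := hP'.symm_and_quadratic_ge hT hM1 hSpd' hS'.A_le hS'.Qinv_le hΓ'
  -- `M` does not control the inverse of `S.Γ`. An enlarged bound is harmless: only symmetry and
  -- nonnegativity of `P` are taken from it, so it does not enter the constant.
  have hlow := hP.symm_and_quadratic_ge hT (M := max M ‖S.Γ⁻¹‖) (le_max_of_le_left hM1) hSpd
    (hS.A_le.trans (le_max_left _ _)) (hS.Qinv_le.trans (le_max_left _ _)) (le_max_right _ _)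
  have hPK' : ∀ t ∈ Set.Icc 0 T, ‖P' t‖ ≤ K := hP'.norm_le hT.le hM0 hS' hSpd'.2.2
    (fun t ht => (hlow' t ht).1) fun t ht v => le_trans (by
      have := dotProduct_self_nonneg_real v
      positivity) ((hlow' t ht).2 v)
  have hPK : ∀ t ∈ Set.Icc 0 T, ‖P t‖ ≤ K := hP.norm_le hT.le hM0 hS hSpd.2.2
    (fun t ht => (hlow t ht).1) fun t ht v => le_trans (by
      have := dotProduct_self_nonneg_real v
      positivity) ((hlow t ht).2 v)
  have hgainle : ∀ {S : FilterData n m r} {P : Matrix (Fin n) (Fin n) ℝ}, S.BoundedBy M →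
      ‖P‖ ≤ K → ‖P * Cᵀ * S.Q⁻¹‖ ≤ k := fun {S P} hS hP => (norm_mul_mul_le _ _ _).trans (by
    have := hS.Qinv_le
    rw [norm_transpose_eq, hk]
    gcongr)
  have hdiff := hP.norm_sub_le hT.le hM0.le hK0 hS hS' hSpd.2.2.isUnit hSpd'.2.2.isUnit hP' hPK hPK'
  have hδ := FilterData.norm1_nonneg (S - S')
  have hxle : ∀ t ∈ Set.Icc 0 T, ‖x t‖ ≤ X :=
    hx.norm_le hM0.le hk0 hy hS.A_le fun t ht => hgainle hS (hPK t ht)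
  have hxd : ‖x t - x' t‖ ≤ b * (S - S').norm1 :=
    hx.norm_sub_le hM0.le hk0 hX0 hg0 hδ hy hP.continuousOn hP'.continuousOn hS'.A_le
      (FilterData.norm_sub_le_norm1 S S').1 (fun t ht => hgainle hS' (hPK' t ht))
      (fun t ht => norm_gain_sub_le hM0.le hK0 hc0 hS hS' hSpd.2.2.isUnit hSpd'.2.2.isUnit
        (hPK' t ht) (hdiff t ht)) hxle hx' t ht
  calc weightedNorm (P' t)⁻¹ (x t - x' t) ≤ √e⁻¹ * √n * ‖x t - x' t‖ :=
        weightedNorm_inv_le (hlow' t ht).1 he0 (hlow' t ht).2 _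
    _ ≤ √e⁻¹ * √n * (b * (S - S').norm1) := by gcongr
    _ ≤ (√e⁻¹ * √n * b + 1) * (S - S').norm1 := by linarith

/-- The constant `c` is chosen after the problem data `T, B, C, x₀, y` and a bound `M` on the
averaged and the true matrices, and before the uncertainty model: it depends neither on the number
`N` of parameters nor on the parameter set, the true parameter `σbar`, or the time `t`. -/
theorem mainTheorem4 {n m r : ℕ} (T : ℝ) (hT : 0 < T)
    (B : Matrix (Fin n) (Fin m) ℝ) (C : Matrix (Fin r) (Fin n) ℝ)
    (x₀ : Fin n → ℝ) (y : ℝ → Fin r → ℝ)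
    (hy : MemLp y 2 (volume.restrict (Set.Ioo 0 T))) (M : ℝ) :
    ∃ c : ℝ, 0 < c ∧
      ∀ (U : UncertainModel n m r), ∀ σbar ∈ U.Sigma,
        U.meanData.BoundedBy M → (U.data σbar).BoundedBy M → ‖(U.data σbar).Γ⁻¹‖ ≤ M →
        ∀ (PiE Pibar : ℝ → Matrix (Fin n) (Fin n) ℝ) (xE xbar : ℝ → Fin n → ℝ),
          IsErrorCovariance T B C U.meanData PiE →
          IsKalmanTrajectory T C x₀ y U.meanData PiE xE →
          IsErrorCovariance T B C (U.data σbar) Pibar →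
          IsKalmanTrajectory T C x₀ y (U.data σbar) Pibar xbar →
          ∀ t ∈ Set.Icc 0 T,
            weightedNorm (Pibar t)⁻¹ (xE t - xbar t) ≤
              c * U.expectation fun σ => (U.data σ - U.data σbar).norm1 := by
  have hy' : IntervalIntegrable y volume 0 T := by
    rw [intervalIntegrable_iff_integrableOn_Ioo_of_le hT.le]
    -- On a bounded interval `L²` is contained in `L¹`, and integrability of `y` is all the
    -- estimates need.
    exact hy.integrable one_le_two
  -- Replacing `M` by `max M 1` makes `M⁻¹ ≤ 1`, as the barrier requires.
  obtain ⟨c, hc, h⟩ := exists_weightedNorm_sub_le T hT B C x₀ y hy' (le_max_right M 1)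
  refine ⟨c, hc, fun U σbar hσ hE hbar hΓ PiE Pibar xE xbar hPiE hxE hPibar hxbar t ht => ?_⟩
  refine (h U.meanData (U.data σbar) (UncertainModel.meanData_posDef hσ)
    (UncertainModel.data_posDef hσ) (hE.mono (le_max_left _ _)) (hbar.mono (le_max_left _ _))
    (hΓ.trans (le_max_left _ _)) PiE Pibar xE xbar hPiE hxE hPibar hxbar t ht).trans ?_
  exact mul_le_mul_of_nonneg_left (UncertainModel.norm1_meanData_sub_le hσ) hc.le
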